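/- Consider Bell tests with $n$ sites, where site $j$ has an input $s_j\in\{0,1\}$ and an output $m_j\in\{0,1\}$. In a quantum experiment the behaviour is $p(\mathbf m|\mathbf s)=\mathrm{Tr}\big(\rho\bigotimes_{j=1}^n P^{s_j}_{m_j}\big)$, where $\rho$ is a density matrix on a tensor product of $n$ Hilbert spaces of arbitrary dimension and, for each site and input, $\{P^{s_j}_0,P^{s_j}_1\}$ is a POVM on that site's space. The inputs $\mathbf s$ are chosen uniformly at random. A Boolean function is called linear if it is a sum modulo $2$ of some of its variables and a constant. Let $\mathbf x$ be a bit-string of length $|\mathbf x|$. In linear output-input post-selection (LOI) the data $(\mathbf m,\mathbf s)$ are accepted for the value $\mathbf x$ if $s_j=g_j(\mathbf x,\mathbf m^{\setminus j})$ for every $j$, where each $g_j$ is a fixed linear Boolean function of the bits of $\mathbf x$ and of the outputs $\mathbf m^{\setminus j}$ of the other sites. Linear input post-selection (LI) is the case in which every $g_j$ depends on $\mathbf x$ only. For post-selections that accept with positive probability for every $\mathbf x$, the correlator is $p(1|\mathbf x)=\Pr\big(\bigoplus_j m_j=1\,\big|\,\text{data accepted for }\mathbf x\big)$. Let $\mathcal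 Q^{n}_{\mathrm{LI},|\mathbf x|}$ and $\mathcal Q^{n}_{\mathrm{LOI},|\mathbf x|}$ be the sets of all functions $\mathbf x\mapsto p(1|\mathbf x)$ that arise from $n$-site quantum experiments under LI and LOI, and let $v$ be the vertex $p(1|\mathbf x)=\delta^1_{f(\mathbf x)}$ with $f(\mathbf x)=\prod_{j=1}^{|\mathbf x|}x_j$. 1. For every $|\mathbf x|\ge 2$, $v\in\mathcal Q^{n}_{\mathrm{LOI},|\mathbf x|}$ for $n=3(|\mathbf x|-1)$. 2. For every $|\mathbf x|\ge 1$, the least $n$ with $v\in\mathcal Q^{n}_{\mathrm{LI},|\mathbf x|}$ is $2^{|\mathbf x|}-1$. This is also the least number of parties with which non-adaptive measurement-based quantum computation (nMBQC) performs $f$ deterministically, that is, with which, for some pure $n$-partite state, some POVMs and some inputs $s_j$ that are linear Boolean functions of $\mathbf x$, $\bigoplus_j m_j=f(\mathbf x)$ with probability $1$ for every $\mathbf x$. 3. $\mathcal Q^{n}_{\mathrm{LI},|\mathbf x|}\subseteq\mathcal Q^{n}_{\mathrm{LOI},|\mathbf x|}$ for all $n$ and $|\mathbf x|$, and the inclusion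 is strict for every $|\mathbf x|\ge 3$ and $n=3(|\mathbf x|-1)$. In particular, the LOI set can be strictly larger than the LI set for fixed $n$ and $|\mathbf x|$. -/

import Mathlib

open scoped BigOperators ComplexOrder Matrix

noncomputable section

namespace BellTest

/-! ### Tensor products of finitely many Hilbert spaces -/

/-- `H` is the Hilbert-space tensor product of the spaces `E j`: there is a multilinear map
`(v j) ↦ ⨂ v j` with `⟪⨂ v j, ⨂ w j⟫ = ∏ ⟪v j, w j⟫` whose image spans a dense subspace.
This determines the (complete) space `H` up to a unique compatible unitary. -/
structure HilbertTensor {n : ℕ} (E : Fin n → Type) [∀ j, NormedAddCommGroup (E j)]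
    [∀ j, InnerProductSpace ℂ (E j)] (H : Type) [NormedAddCommGroup H]
    [InnerProductSpace ℂ H] where
  /-- the product vector `⨂ v j` -/
  tmul : MultilinearMap ℂ E H
  inner_tmul : ∀ v w : ∀ j, E j, inner ℂ (tmul v) (tmul w) = ∏ j, inner ℂ (v j) (w j)
  dense_span : Dense (Submodule.span ℂ (Set.range tmul) : Set H)

namespace HilbertTensor

variable {n : ℕ} {E : Fin n → Type} [∀ j, NormedAddCommGroup (E j)]
  [∀ j, InnerProductSpace ℂ (E j)] {H : Type} [NormedAddCommGroup H]
  [InnerProductSpace ℂ H]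

/-- The linear map from the algebraic tensor product to the Hilbert tensor product. -/
def ofAlg (T : HilbertTensor E H) : (PiTensorProduct ℂ fun j => E j) →ₗ[ℂ] H :=
  PiTensorProduct.lift T.tmul

/-- The bounded operator `⨂ A j` on the tensor product: the continuous extension of the algebraic
tensor product of the operators `A j`. -/
def tensorOp [CompleteSpace H] (T : HilbertTensor E H) (A : ∀ j, E j →L[ℂ] E j) : H →L[ℂ] H :=
  (T.ofAlg ∘ₗ PiTensorProduct.map fun j => (A j).toLinearMap).extendOfNorm T.ofAlg

theorem denseRange_ofAlg (T : HilbertTensor E H) : DenseRange T.ofAlg := by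
  have h : (Submodule.span ℂ (Set.range T.tmul) : Set H) ⊆ Set.range T.ofAlg := by
    have : Submodule.span ℂ (Set.range T.tmul) ≤ LinearMap.range T.ofAlg := by
      rw [Submodule.span_le]
      rintro _ ⟨v, rfl⟩
      exact ⟨PiTensorProduct.tprod ℂ v, by simp [ofAlg]⟩
    exact this
  exact T.dense_span.mono h

theorem posSemidef_prod_sub {N : ℕ} (B D : Fin n → Matrix (Fin N) (Fin N) ℂ)
    (hB : ∀ j, (B j).PosSemidef) (hBD : ∀ j, (D j - B j).PosSemidef) (S : Finset (Fin n)) :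
    (Matrix.of fun a b => ∏ j ∈ S, B j a b).PosSemidef ∧
      (Matrix.of fun a b => ∏ j ∈ S, D j a b - ∏ j ∈ S, B j a b).PosSemidef := by
  induction S using Finset.induction_on with
  | empty =>
    constructor
    · have h := Matrix.posSemidef_vecMulVec_self_star (fun _ : Fin N => (1 : ℂ))
      convert h using 1
      ext a b
      simp [Matrix.vecMulVec_apply]
    · convert (Matrix.PosSemidef.zero (n := Fin N) (R := ℂ)) using 1
      ext a b
      simp
  | insert i S hi ih =>
    obtain ⟨h1, h2⟩ := ih
    have hD : (D i).PosSemidef := by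
      have := (hBD i).add (hB i)
      simpa using this
    constructor
    · have h := (hB i).hadamard h1
      have e : (Matrix.of fun a b => ∏ j ∈ insert i S, B j a b) =
          B i ⊙ Matrix.of fun a b => ∏ j ∈ S, B j a b := by
        ext a b
        simp [Finset.prod_insert hi]
      rw [e]
      exact h
    · have h := (hD.hadamard h2).add ((hBD i).hadamard h1)
      have e : (Matrix.of fun a b => ∏ j ∈ insert i S, D j a b - ∏ j ∈ insert i S, B j a b) =
          (D i ⊙ Matrix.of fun a b => ∏ j ∈ S, D j a b - ∏ j ∈ S, B j a b) +
            (D i - B i) ⊙ Matrix.of fun a b => ∏ j ∈ S, B j a b := by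
        ext a b
        simp [Finset.prod_insert hi]
        ring
      rw [e]
      exact h

theorem norm_ofAlg_map_le (T : HilbertTensor E H) (A : ∀ j, E j →L[ℂ] E j)
    (z : PiTensorProduct ℂ fun j => E j) :
    ‖T.ofAlg (PiTensorProduct.map (fun j => (A j).toLinearMap) z)‖ ≤
      (∏ j, ‖A j‖) * ‖T.ofAlg z‖ := by
  have hz : z ∈ Submodule.span ℂ (Set.range (PiTensorProduct.tprod ℂ (s := fun j => E j))) := by
    rw [PiTensorProduct.span_tprod_eq_top]; trivial
  obtain ⟨N, c, g, rfl⟩ := Submodule.mem_span_set'.1 hz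
  choose v hv using fun a => (g a).2
  simp only [← hv]
  have key : ∀ w : Fin N → ∀ j, E j,
      ((‖∑ a, c a • T.tmul (w a)‖ ^ 2 : ℝ) : ℂ) =
        star c ⬝ᵥ ((Matrix.of fun a b => ∏ j, Matrix.gram ℂ (fun a => w a j) a b) *ᵥ c) := by
    intro w
    have h1 := Matrix.star_dotProduct_gram_mulVec (𝕜 := ℂ) (fun a => T.tmul (w a)) c c
    have h2 : Matrix.gram ℂ (fun a => T.tmul (w a)) =
        Matrix.of fun a b => ∏ j, Matrix.gram ℂ (fun a => w a j) a b := by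
      ext a b
      simp [T.inner_tmul]
    rw [← h2, h1, inner_self_eq_norm_sq_to_K]
    simp
  have hPS := (posSemidef_prod_sub
    (fun j => Matrix.gram ℂ fun a => A j (v a j))
    (fun j => ((‖A j‖ ^ 2 : ℝ) : ℂ) • Matrix.gram ℂ fun a => v a j)
    (fun j => Matrix.posSemidef_gram ℂ _) (fun j => by
      refine Matrix.PosSemidef.of_dotProduct_mulVec_nonneg ?_ fun x => ?_
      · refine Matrix.IsHermitian.sub ?_ (Matrix.isHermitian_gram ℂ _)
        have := (Matrix.isHermitian_gram ℂ (fun a => v a j))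
        ext a b
        simp only [Matrix.conjTranspose_apply, Matrix.smul_apply, Matrix.gram_apply, smul_eq_mul,
          star_mul', RCLike.star_def, Complex.conj_ofReal, inner_conj_symm]
      · rw [Matrix.sub_mulVec, dotProduct_sub, Matrix.smul_mulVec, dotProduct_smul,
          Matrix.star_dotProduct_gram_mulVec, Matrix.star_dotProduct_gram_mulVec,
          inner_self_eq_norm_sq_to_K, inner_self_eq_norm_sq_to_K]
        have h3 : ∑ i, x i • A j (v i j) = A j (∑ i, x i • v i j) := by simp
        rw [h3]
        have h4 := (A j).le_opNorm (∑ i, x i • v i j)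
        have h5 : ‖A j (∑ i, x i • v i j)‖ ^ 2 ≤ ‖A j‖ ^ 2 * ‖∑ i, x i • v i j‖ ^ 2 := by
          rw [← mul_pow]
          exact pow_le_pow_left₀ (norm_nonneg _) h4 2
        rw [sub_nonneg, smul_eq_mul]
        have h8 := Complex.real_le_real.2 h5
        push_cast at h8 ⊢
        exact h8) Finset.univ).2.dotProduct_mulVec_nonneg c
  have hsplit : (Matrix.of fun a b =>
      ∏ j, (((‖A j‖ ^ 2 : ℝ) : ℂ) • Matrix.gram ℂ fun a => v a j) a b -
        ∏ j, (Matrix.gram ℂ fun a => A j (v a j)) a b) =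
      (((∏ j, ‖A j‖) ^ 2 : ℝ) : ℂ) •
        (Matrix.of fun a b => ∏ j, Matrix.gram ℂ (fun a => v a j) a b) -
        Matrix.of fun a b => ∏ j, Matrix.gram ℂ (fun a => A j (v a j)) a b := by
    ext a b
    simp [Finset.prod_mul_distrib, Finset.prod_pow]
  rw [hsplit, Matrix.sub_mulVec, dotProduct_sub, Matrix.smul_mulVec, dotProduct_smul,
    ← key v, ← key fun a j => A j (v a j), sub_nonneg, smul_eq_mul] at hPS
  have h6 : ‖∑ a, c a • T.tmul fun j => A j (v a j)‖ ^ 2 ≤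
      ((∏ j, ‖A j‖) * ‖∑ a, c a • T.tmul (v a)‖) ^ 2 := by
    rw [mul_pow]
    exact_mod_cast hPS
  have h7 := abs_le_of_sq_le_sq h6
    (mul_nonneg (Finset.prod_nonneg fun j _ => norm_nonneg _) (norm_nonneg _))
  simpa [ofAlg] using (le_abs_self _).trans h7

/-- `(⨂ A j) (⨂ v j) = ⨂ (A j (v j))`. -/
theorem tensorOp_tmul [CompleteSpace H] (T : HilbertTensor E H) (A : ∀ j, E j →L[ℂ] E j)
    (v : ∀ j, E j) : T.tensorOp A (T.tmul v) = T.tmul fun j => A j (v j) := by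
  have h := LinearMap.extendOfNorm_eq
    (f := T.ofAlg ∘ₗ PiTensorProduct.map fun j => (A j).toLinearMap)
    T.denseRange_ofAlg ⟨_, T.norm_ofAlg_map_le A⟩ (PiTensorProduct.tprod ℂ v)
  simpa [tensorOp, ofAlg] using h

end HilbertTensor

/-! ### Quantum behaviours in the `(n,2,2)` scenario -/

/-- A quantum experiment with `n` sites, two inputs and two outputs per site: Hilbert spaces of
arbitrary dimension at the sites, a density matrix on their tensor product, given as a
mixture `∑ w l |ψ l⟩⟨ψ l|` of pure states, and at every site a two-outcome POVM for each of the two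
inputs. -/
structure QuantumExperiment (n : ℕ) where
  /-- Hilbert space of site `j` -/
  E : Fin n → Type
  [normedE : ∀ j, NormedAddCommGroup (E j)]
  [innerE : ∀ j, InnerProductSpace ℂ (E j)]
  [completeE : ∀ j, CompleteSpace (E j)]
  /-- Hilbert space of the whole system -/
  H : Type
  [normedH : NormedAddCommGroup H]
  [innerH : InnerProductSpace ℂ H]
  [completeH : CompleteSpace H]
  /-- `H` is the tensor product of the `E j` -/
  tensor : HilbertTensor E H
  /-- weights of the mixture -/
  w : ℕ → ℝ
  w_nonneg : ∀ l, 0 ≤ w l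
  w_sum : HasSum w 1
  /-- pure states of the mixture -/
  ψ : ℕ → H
  norm_ψ : ∀ l, ‖ψ l‖ = 1
  /-- `povm j s m` is the effect of outcome `m` at site `j` on input `s` -/
  povm : ∀ j, ZMod 2 → ZMod 2 → (E j →L[ℂ] E j)
  povm_pos : ∀ j s m, (povm j s m).IsPositive
  povm_sum : ∀ j s, ∑ m, povm j s m = 1

attribute [instance] QuantumExperiment.normedE QuantumExperiment.innerE
  QuantumExperiment.completeE QuantumExperiment.normedH QuantumExperiment.innerH
  QuantumExperiment.completeH

namespace QuantumExperiment

variable {n : ℕ}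

/-- The Born rule `p(m|s) = Tr(ρ ⨂ P_j^{s_j, m_j})`. -/
def prob (Q : QuantumExperiment n) (s m : Fin n → ZMod 2) : ℝ :=
  ∑' l, Q.w l * (inner ℂ (Q.ψ l) (Q.tensor.tensorOp (fun j => Q.povm j (s j) (m j)) (Q.ψ l))).re

/-- The state is pure. -/
def IsPure (Q : QuantumExperiment n) : Prop := ∃ l, Q.w l = 1

end QuantumExperiment

/-! ### Linear Boolean functions and post-selection -/

/-- Linear Boolean functions: sums modulo 2 of some of the variables and of a constant. -/
def IsLinearBoolean {ι : Type} [Fintype ι] (f : (ι → ZMod 2) → ZMod 2) : Prop :=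
  ∃ (a : ι → ZMod 2) (b : ZMod 2), ∀ s, f s = ∑ i, a i * s i + b

/-- An output-input post-selection rule with `n` parties and a `k`-bit string `x`: the
data are accepted if `s j = g j x m^{∖j}` for every `j`, where `m^{∖j}` are the outputs of
the parties other than `j`. -/
abbrev PostSelection (n k : ℕ) : Type :=
  ∀ j : Fin n, (Fin k → ZMod 2) → ({i : Fin n // i ≠ j} → ZMod 2) → ZMod 2

namespace PostSelection

variable {n k : ℕ}

/-- The data `(m, s)` are accepted for the value `x`. -/
def Accepts (g : PostSelection n k) (x : Fin k → ZMod 2) (s m : Fin n → ZMod 2) : Prop :=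
  ∀ j, s j = g j x fun i => m i

/-- Linear output-input post-selection (LOI): every `g j` is a linear Boolean function of the
bits of `x` and of `m^{∖j}`. -/
def IsLOI (g : PostSelection n k) : Prop :=
  ∀ j, IsLinearBoolean fun y : Fin k ⊕ {i : Fin n // i ≠ j} → ZMod 2 =>
    g j (fun a => y (Sum.inl a)) fun i => y (Sum.inr i)

/-- Linear input post-selection (LI): every `g j` depends on `x` only, and is a linear
Boolean function of `x`. -/
def IsLI (g : PostSelection n k) : Prop :=
  ∃ h : Fin n → (Fin k → ZMod 2) → ZMod 2, (∀ j, IsLinearBoolean (h j)) ∧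
    ∀ j x m, g j x m = h j x

end PostSelection

open Classical in
/-- The joint probability, for uniformly random inputs `s`, that the data are accepted for `x`
and that `(s, m)` satisfy `C`. -/
def acceptedProb {n k : ℕ} (Q : QuantumExperiment n) (g : PostSelection n k)
    (x : Fin k → ZMod 2) (C : (Fin n → ZMod 2) → (Fin n → ZMod 2) → Prop) : ℝ :=
  ∑ s : Fin n → ZMod 2, ∑ m : Fin n → ZMod 2,
    if g.Accepts x s m ∧ C s m then (1 / 2 : ℝ) ^ n * Q.prob s m else 0

/-- `p` is the correlator `x ↦ p(1|x) = p(⊕ m_j = 1 | x)` of the experiment `Q` after the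
post-selection `g`: for every `x` data are accepted with positive probability, and `p x` is the
conditional probability, given acceptance, that the outputs sum to `1` modulo 2. -/
def IsCorrelator {n k : ℕ} (Q : QuantumExperiment n) (g : PostSelection n k)
    (p : (Fin k → ZMod 2) → ℝ) : Prop :=
  ∀ x, 0 < acceptedProb Q g x (fun _ _ => True) ∧
    p x = acceptedProb Q g x (fun _ m => ∑ j, m j = 1) / acceptedProb Q g x (fun _ _ => True)

/-- The space of `n`-party quantum correlators `p(1|x)`, `|x| = k`, under LI. -/
def liCorrelators (n k : ℕ) : Set ((Fin k → ZMod 2) → ℝ) :=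
  {p | ∃ (Q : QuantumExperiment n) (g : PostSelection n k), g.IsLI ∧ IsCorrelator Q g p}

/-- The space of `n`-party quantum correlators `p(1|x)`, `|x| = k`, under LOI. -/
def loiCorrelators (n k : ℕ) : Set ((Fin k → ZMod 2) → ℝ) :=
  {p | ∃ (Q : QuantumExperiment n) (g : PostSelection n k), g.IsLOI ∧ IsCorrelator Q g p}

/-- The deterministic correlator `p(1|x) = δ^1_{f(x)}`. -/
def vertex {k : ℕ} (f : (Fin k → ZMod 2) → ZMod 2) : (Fin k → ZMod 2) → ℝ :=
  fun x => if f x = 1 then 1 else 0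

/-- The product (AND) of all bits. -/
def prodFn (k : ℕ) : (Fin k → ZMod 2) → ZMod 2 := fun x => ∏ j, x j

/-- `f` can be performed deterministically by non-adaptive measurement-based quantum computation
(nMBQC) with `n` parties: on a pure `n`-partite resource state, with the measurement choices `s j`
computed from `x` as linear Boolean functions, the parity of the outcomes is `f x` with
certainty for every `x`. -/
def PerformedByNMBQC (n : ℕ) {k : ℕ} (f : (Fin k → ZMod 2) → ZMod 2) : Prop :=
  ∃ (Q : QuantumExperiment n) (h : Fin n → (Fin k → ZMod 2) → ZMod 2),
    Q.IsPure ∧ (∀ j, IsLinearBoolean (h j)) ∧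
      ∀ x, ∑ m with ∑ j, m j = f x, Q.prob (fun j => h j x) m = 1

end BellTest

end

/-!
Under LI the inputs are fixed affine functions of `x`, so attaining the vertex of `f` means that
the observables `B_j(x)` of the sites satisfy `(⨂ B_j(x)) ψ = (-1)^{f x} ψ` for every `x`. If some
nonzero linear form `a` is the linear part of no input, split the strings into pairs `(x, x + e)`
along the hyperplane `a · x = 0`, where `a · e = 1`. The tensor product of the corresponding
products `B_j(x) B_j(x + e)` multiplies `ψ` by `(-1)^{∑ f}`. At each site such a product acts on
`ψ` like a power of a single unitary, with exponents that cancel over the hyperplane because the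
linear part of the input is not `a`; hence `∑ f = 0`. For the product of `k` bits `∑ f = 1`, so all
`2 ^ k - 1` nonzero linear forms must occur. Conversely, a GHZ state with one qubit for each of them
computes `f`: the measurement angles of a GHZ state add up, and every real function of `x` which
vanishes at `0` is a linear combination of the bits `a · x`.

Under LOI the inputs may depend on outputs. Three qubits of a GHZ state suffice to multiply two bits
`u`, `v`: with inputs `u`, `v`, `u + v` and slopes `π/2`, `π/2`, `-π/2` the angles add up to
`π u v`. Feeding the parity of the earlier outputs into the next GHZ state multiplies the `k` bits
one after the other with `k - 1` such states.
-/

namespace BellTest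

theorem zmod_two_cases (b : ZMod 2) : b = 0 ∨ b = 1 := by
  revert b; decide

theorem sum_zmod_two {M : Type*} [AddCommMonoid M] (f : ZMod 2 → M) :
    ∑ b, f b = f 0 + f 1 := Fin.sum_univ_two f

theorem norm_sub_le_one_of_add_eq_one {A : Type*} [CStarAlgebra A] [PartialOrder A]
    [StarOrderedRing A] {a b : A} (ha : 0 ≤ a) (hb : 0 ≤ b) (hab : a + b = 1) :
    ‖a - b‖ ≤ 1 := by
  obtain rfl : b = 1 - a := eq_sub_of_add_eq' hab
  have hcomm : Commute a (1 - a) := (Commute.one_right a).sub_right (Commute.refl a)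
  have hstar : star (a - (1 - a)) = a - (1 - a) :=
    (IsSelfAdjoint.of_nonneg ha).sub (IsSelfAdjoint.of_nonneg hb)
  have hsq : star (a - (1 - a)) * (a - (1 - a)) = 1 - (4 : ℕ) • (a * (1 - a)) := by
    rw [hstar]; noncomm_ring
  have hle : star (a - (1 - a)) * (a - (1 - a)) ≤ 1 := by
    rw [hsq]
    exact sub_le_self _ (nsmul_nonneg (hcomm.mul_nonneg ha hb) 4)
  have hnorm := (CStarAlgebra.norm_le_one_iff_of_nonneg _ (star_mul_self_nonneg _)).2 hle
  rw [CStarRing.norm_star_mul_self] at hnorm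
  nlinarith [norm_nonneg (a - (1 - a))]

section Operators

variable {F : Type*} [NormedAddCommGroup F] [InnerProductSpace ℂ F] [CompleteSpace F]

theorem apply_eq_zero_of_nonneg {A : F →L[ℂ] F} (hA : 0 ≤ A) {x : F}
    (hx : (inner ℂ x (A x)).re = 0) : A x = 0 := by
  obtain ⟨B, rfl⟩ := CStarAlgebra.nonneg_iff_eq_star_mul_self.1 hA
  have hinner : inner ℂ x ((star B * B) x) = inner ℂ (B x) (B x) := B.adjoint_inner_right x (B x)
  have hB : B x = 0 := by
    rw [hinner, inner_self_eq_norm_sq_to_K] at hx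
    simpa [← Complex.ofReal_pow] using hx
  rw [mul_apply_eq_comp, hB, map_zero]

theorem apply_apply_of_norm_apply_eq {A : F →L[ℂ] F} (hsa : IsSelfAdjoint A) (hA : ‖A‖ ≤ 1)
    {v : F} (hv : ‖A v‖ = ‖v‖) : A (A v) = v := by
  have hle : ‖A (A v)‖ ≤ ‖v‖ := by
    simpa [hv] using A.le_of_opNorm_le hA (A v)
  have hinner : inner ℂ (A (A v)) v = (‖v‖ : ℂ) ^ 2 := by
    rw [← hv]
    exact (hsa.isSymmetric (A v) v).trans (inner_self_eq_norm_sq_to_K (A v))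
  have hsub := norm_sub_sq (𝕜 := ℂ) (A (A v)) v
  rw [hinner, RCLike.re_eq_complex_re, ← Complex.ofReal_pow, Complex.ofReal_re] at hsub
  have hsq := pow_le_pow_left₀ (norm_nonneg _) hle 2
  have hzero : ‖A (A v) - v‖ ^ 2 = 0 := le_antisymm (by linarith) (sq_nonneg _)
  exact sub_eq_zero.1 (norm_eq_zero.1 (pow_eq_zero_iff two_ne_zero |>.1 hzero))

end Operators

namespace HilbertTensor

variable {n : ℕ} {E : Fin n → Type} [∀ j, NormedAddCommGroup (E j)]
  [∀ j, InnerProductSpace ℂ (E j)] {H : Type} [NormedAddCommGroup H]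
  [InnerProductSpace ℂ H]

theorem ext_tmul {F : Type*} [NormedAddCommGroup F] [NormedSpace ℂ F]
    (T : HilbertTensor E H) {f g : H →L[ℂ] F} (h : ∀ v, f (T.tmul v) = g (T.tmul v)) : f = g :=
  ContinuousLinearMap.ext_on T.dense_span (Set.forall_mem_range.2 h)

variable [CompleteSpace H]

/-- The product operator `⨂ A j`, bundled as a monoid homomorphism in the family `A`. -/
noncomputable def tensorHom (T : HilbertTensor E H) : (∀ j, E j →L[ℂ] E j) →* (H →L[ℂ] H) where
  toFun := T.tensorOp
  map_one' := T.ext_tmul fun v => by simp [tensorOp_tmul]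
  map_mul' A B := T.ext_tmul fun v => by simp [tensorOp_tmul]

@[simp] theorem tensorHom_tmul (T : HilbertTensor E H) (A : ∀ j, E j →L[ℂ] E j) (v : ∀ j, E j) :
    T.tensorHom A (T.tmul v) = T.tmul fun j => A j (v j) :=
  T.tensorOp_tmul A v

theorem norm_tensorHom_le_one (T : HilbertTensor E H) {A : ∀ j, E j →L[ℂ] E j}
    (hA : ∀ j, ‖A j‖ ≤ 1) : ‖T.tensorHom A‖ ≤ 1 :=
  (LinearMap.opNorm_extendOfNorm_le T.denseRange_ofAlg
      (Finset.prod_nonneg fun j _ => norm_nonneg (A j)) (T.norm_ofAlg_map_le A)).trans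
    (Finset.prod_le_one (fun _ _ => norm_nonneg _) fun j _ => hA j)

theorem tensorHom_sum (T : HilbertTensor E H) {ι : Type*} [Fintype ι]
    (A : ∀ j, ι → E j →L[ℂ] E j) :
    T.tensorHom (fun j => ∑ i, A j i) = ∑ m : Fin n → ι, T.tensorHom fun j => A j (m j) := by
  classical
  refine T.ext_tmul fun v => ?_
  simp only [tensorHom_tmul, sum_apply]
  exact T.tmul.map_sum fun j i => A j i (v j)

theorem tensorHom_smul (T : HilbertTensor E H) (c : Fin n → ℂ) (A : ∀ j, E j →L[ℂ] E j) :
    T.tensorHom (fun j => c j • A j) = (∏ j, c j) • T.tensorHom A :=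
  T.ext_tmul fun v => by
    simpa only [tensorHom_tmul, smul_apply] using T.tmul.map_smul_univ c _

theorem tensorHom_star [∀ j, CompleteSpace (E j)] (T : HilbertTensor E H)
    (A : ∀ j, E j →L[ℂ] E j) : T.tensorHom (star A) = star (T.tensorHom A) := by
  refine T.ext_tmul fun v => innerSL_inj.1 (T.ext_tmul fun w => ?_)
  rw [innerSL_apply_apply, innerSL_apply_apply, ContinuousLinearMap.star_eq_adjoint,
    ContinuousLinearMap.adjoint_inner_left, tensorHom_tmul, tensorHom_tmul, T.inner_tmul,
    T.inner_tmul]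
  exact Finset.prod_congr rfl fun j _ => (A j).adjoint_inner_left (w j) (v j)

theorem isSelfAdjoint_tensorHom [∀ j, CompleteSpace (E j)] (T : HilbertTensor E H)
    {A : ∀ j, E j →L[ℂ] E j} (hA : IsSelfAdjoint A) : IsSelfAdjoint (T.tensorHom A) := by
  rw [isSelfAdjoint_iff, ← tensorHom_star, hA.star_eq]

theorem tensorHom_nonneg [∀ j, CompleteSpace (E j)] (T : HilbertTensor E H)
    {A : ∀ j, E j →L[ℂ] E j} (hA : ∀ j, 0 ≤ A j) : 0 ≤ T.tensorHom A := by
  choose B hB using fun j => CStarAlgebra.nonneg_iff_eq_star_mul_self.1 (hA j)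
  rw [show A = star B * B from funext hB, map_mul, tensorHom_star]
  exact star_mul_self_nonneg _

theorem tensorHom_apply_eq_self_of_mulSingle (T : HilbertTensor E H) {A : ∀ j, E j →L[ℂ] E j}
    {x : H} (h : ∀ j, T.tensorHom (Pi.mulSingle j (A j)) x = x) : T.tensorHom A x = x :=
  Submonoid.pi_mem_of_mulSingle_mem
    (H := (MulAction.stabilizerSubmonoid (H →L[ℂ] H) x).comap T.tensorHom) A h

theorem norm_tensorHom_mulSingle_apply (T : HilbertTensor E H) {A : ∀ j, E j →L[ℂ] E j}
    (hA : ∀ j, ‖A j‖ ≤ 1) {x : H} (hx : ‖T.tensorHom A x‖ = ‖x‖) (j : Fin n) :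
    ‖T.tensorHom (Pi.mulSingle j (A j)) x‖ = ‖x‖ := by
  have hone : ∀ i, ‖(1 : E i →L[ℂ] E i)‖ ≤ 1 := fun i => ContinuousLinearMap.norm_id_le
  have hupdate : ∀ i, ‖Function.update A j 1 i‖ ≤ 1 := fun i => by
    rcases eq_or_ne i j with rfl | hi <;> simp [*]
  have hsingle : ∀ i, ‖(Pi.mulSingle j (A j) : ∀ i, E i →L[ℂ] E i) i‖ ≤ 1 := fun i => by
    rcases eq_or_ne i j with rfl | hi <;> simp [*]
  have hsplit : A = Function.update A j 1 * Pi.mulSingle j (A j) := by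
    funext i
    rcases eq_or_ne i j with rfl | hi <;> simp [*]
  refine le_antisymm ?_ ?_
  · simpa using (T.tensorHom _).le_of_opNorm_le (T.norm_tensorHom_le_one hsingle) x
  · rw [hsplit, map_mul, mul_apply_eq_comp] at hx
    simpa [hx] using (T.tensorHom _).le_of_opNorm_le (T.norm_tensorHom_le_one hupdate)
      (T.tensorHom (Pi.mulSingle j (A j)) x)

end HilbertTensor

/-- The sign `(-1)^b` as an additive character of `ZMod 2`, so that parities of bits become
products of signs. -/
def sgn : AddChar (ZMod 2) ℝ := AddChar.zmodChar 2 (neg_one_sq (R := ℝ))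

@[simp] theorem sgn_one : sgn 1 = -1 := pow_one (-1 : ℝ)

theorem sgn_sum {ι : Type*} (S : Finset ι) (f : ι → ZMod 2) :
    sgn (∑ i ∈ S, f i) = ∏ i ∈ S, sgn (f i) :=
  map_prod sgn.toMonoidHom (fun i => Multiplicative.ofAdd (f i)) S

namespace QuantumExperiment

variable {n : ℕ} (Q : QuantumExperiment n)

/-- The operator `⨂ P_j^{s_j, m_j}` of the Born rule. -/
noncomputable def effect (s m : Fin n → ZMod 2) : Q.H →L[ℂ] Q.H :=
  Q.tensor.tensorHom fun j => Q.povm j (s j) (m j)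

theorem povm_nonneg (j : Fin n) (s m : ZMod 2) : 0 ≤ Q.povm j s m :=
  (ContinuousLinearMap.nonneg_iff_isPositive _).2 (Q.povm_pos j s m)

theorem effect_nonneg (s m : Fin n → ZMod 2) : 0 ≤ Q.effect s m :=
  Q.tensor.tensorHom_nonneg fun j => Q.povm_nonneg j (s j) (m j)

theorem sum_effect (s : Fin n → ZMod 2) : ∑ m, Q.effect s m = 1 := by
  have hone : (fun j => ∑ b, Q.povm j (s j) b) = 1 := funext fun j => Q.povm_sum j (s j)
  simp only [effect]
  rw [← Q.tensor.tensorHom_sum fun j b => Q.povm j (s j) b, hone, map_one]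

/-- The Born probability in the `l`-th pure state of the mixture. -/
noncomputable def pureProb (s m : Fin n → ZMod 2) (l : ℕ) : ℝ :=
  (inner ℂ (Q.ψ l) (Q.effect s m (Q.ψ l))).re

theorem pureProb_nonneg (s m : Fin n → ZMod 2) (l : ℕ) : 0 ≤ Q.pureProb s m l :=
  ((ContinuousLinearMap.nonneg_iff_isPositive _).1 (Q.effect_nonneg s m)).re_inner_nonneg_right _

theorem sum_pureProb (s : Fin n → ZMod 2) (l : ℕ) : ∑ m, Q.pureProb s m l = 1 := by
  simp only [pureProb]
  rw [← Complex.re_sum, ← inner_sum, ← sum_apply, sum_effect]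
  simp [inner_self_eq_norm_sq_to_K, Q.norm_ψ]

theorem pureProb_le_one (s m : Fin n → ZMod 2) (l : ℕ) : Q.pureProb s m l ≤ 1 :=
  (Finset.single_le_sum (fun m _ => Q.pureProb_nonneg s m l) (Finset.mem_univ m)).trans_eq
    (Q.sum_pureProb s l)

theorem hasSum_prob (s m : Fin n → ZMod 2) :
    HasSum (fun l => Q.w l * Q.pureProb s m l) (Q.prob s m) :=
  Summable.hasSum <| Q.w_sum.summable.of_nonneg_of_le
    (fun l => mul_nonneg (Q.w_nonneg l) (Q.pureProb_nonneg s m l))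
    fun l => mul_le_of_le_one_right (Q.w_nonneg l) (Q.pureProb_le_one s m l)

theorem prob_nonneg (s m : Fin n → ZMod 2) : 0 ≤ Q.prob s m :=
  (Q.hasSum_prob s m).nonneg fun l => mul_nonneg (Q.w_nonneg l) (Q.pureProb_nonneg s m l)

theorem sum_prob (s : Fin n → ZMod 2) : ∑ m, Q.prob s m = 1 := by
  have h := hasSum_sum fun m (_ : m ∈ Finset.univ) => Q.hasSum_prob s m
  simp_rw [← Finset.mul_sum, Q.sum_pureProb, mul_one] at h
  exact h.unique Q.w_sum

theorem exists_prob_ne_zero (s : Fin n → ZMod 2) : ∃ m, Q.prob s m ≠ 0 := by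
  by_contra! h
  simpa [h] using Q.sum_prob s

theorem sum_prob_eq_one_iff (s : Fin n → ZMod 2) (C : (Fin n → ZMod 2) → Prop)
    [DecidablePred C] : ∑ m with C m, Q.prob s m = 1 ↔ ∀ m, Q.prob s m ≠ 0 → C m := by
  rw [← Q.sum_prob s, ← Finset.sum_filter_add_sum_filter_not Finset.univ C, left_eq_add,
    Finset.sum_eq_zero_iff_of_nonneg fun m _ => Q.prob_nonneg s m]
  simp only [Finset.mem_filter_univ, ne_eq]
  exact forall_congr' fun m => not_imp_comm

theorem exists_weight_pos : ∃ l, 0 < Q.w l := by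
  by_contra! h
  have hw : Q.w = 0 := funext fun l => le_antisymm (h l) (Q.w_nonneg l)
  exact zero_ne_one (hasSum_zero.unique (hw ▸ Q.w_sum))

theorem effect_apply_of_prob_eq_zero {s m : Fin n → ZMod 2} (h : Q.prob s m = 0) {l : ℕ}
    (hl : 0 < Q.w l) : Q.effect s m (Q.ψ l) = 0 := by
  have hsum := Q.hasSum_prob s m
  rw [h, hasSum_zero_iff_of_nonneg fun l => mul_nonneg (Q.w_nonneg l) (Q.pureProb_nonneg s m l)]
    at hsum
  exact apply_eq_zero_of_nonneg (Q.effect_nonneg s m)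
    ((mul_eq_zero.1 (congrFun hsum l)).resolve_left hl.ne')

/-- The `±1`-valued observable measured at site `j` on input `s`; output `m` has value
`(-1)^m`. -/
noncomputable def obs (j : Fin n) (s : ZMod 2) : Q.E j →L[ℂ] Q.E j :=
  Q.povm j s 0 - Q.povm j s 1

theorem norm_obs_le_one (j : Fin n) (s : ZMod 2) : ‖Q.obs j s‖ ≤ 1 :=
  norm_sub_le_one_of_add_eq_one (Q.povm_nonneg j s 0) (Q.povm_nonneg j s 1)
    (by rw [← Q.povm_sum j s, sum_zmod_two])

theorem isSelfAdjoint_obs (j : Fin n) (s : ZMod 2) : IsSelfAdjoint (Q.obs j s) :=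
  (Q.povm_pos j s 0).isSelfAdjoint.sub (Q.povm_pos j s 1).isSelfAdjoint

theorem tensorHom_obs (s : Fin n → ZMod 2) :
    Q.tensor.tensorHom (fun j => Q.obs j (s j)) = ∑ m, sgn (∑ j, m j) • Q.effect s m := by
  have hobs : (fun j => Q.obs j (s j)) =
      fun j => ∑ b : ZMod 2, (sgn b : ℂ) • Q.povm j (s j) b := by
    funext j
    simp [sum_zmod_two, obs, sub_eq_add_neg]
  rw [hobs, Q.tensor.tensorHom_sum fun j b => (sgn b : ℂ) • Q.povm j (s j) b]
  refine Finset.sum_congr rfl fun m _ => ?_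
  rw [Q.tensor.tensorHom_smul, ← Complex.ofReal_prod, ← sgn_sum, Complex.coe_smul,
    effect]

theorem tensorHom_obs_apply {s : Fin n → ZMod 2} {b : ZMod 2}
    (h : ∀ m, Q.prob s m ≠ 0 → ∑ j, m j = b) {l : ℕ} (hl : 0 < Q.w l) :
    Q.tensor.tensorHom (fun j => Q.obs j (s j)) (Q.ψ l) = sgn b • Q.ψ l := by
  calc Q.tensor.tensorHom (fun j => Q.obs j (s j)) (Q.ψ l)
      = ∑ m, sgn (∑ j, m j) • Q.effect s m (Q.ψ l) := by
        rw [tensorHom_obs, sum_apply]; rfl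
    _ = ∑ m, sgn b • Q.effect s m (Q.ψ l) := by
        refine Finset.sum_congr rfl fun m _ => ?_
        rcases eq_or_ne (Q.prob s m) 0 with hm | hm
        · rw [Q.effect_apply_of_prob_eq_zero hm hl, smul_zero, smul_zero]
        · rw [h m hm]
    _ = sgn b • Q.ψ l := by
        rw [← Finset.smul_sum, ← sum_apply, sum_effect]; rfl

end QuantumExperiment

theorem mul_eq_zpow_of_mul_self {G : Type*} [Group G] {v : ZMod 2 → G}
    (hv : ∀ b, v b * v b = 1) (a b : ZMod 2) :
    v a * v b = (v 0 * v 1) ^ ((b.val : ℤ) - a.val) := by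
  have hval : ((1 : ZMod 2).val : ℤ) = 1 := rfl
  have hinv : v 1 * v 0 = (v 0 * v 1)⁻¹ := by
    rw [mul_inv_rev, inv_eq_of_mul_eq_one_left (hv 0), inv_eq_of_mul_eq_one_left (hv 1)]
  rcases zmod_two_cases a with rfl | rfl <;> rcases zmod_two_cases b with rfl | rfl <;>
    simp [hv, hval, hinv]

theorem exists_prod_map_mul_eq_zpow {G ι : Type*} [Group G] {u : ι → G} {s : ι → ZMod 2}
    (hu : ∀ x, u x * u x = 1) (hs : u.FactorsThrough s) :
    ∃ r : G, ∀ L : List (ι × ι), (L.map fun p => u p.1 * u p.2).prod =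
      r ^ (L.map fun p => ((s p.2).val : ℤ) - (s p.1).val).sum := by
  let v := Function.extend s u 1
  have hvu : ∀ x, v (s x) = u x := hs.extend_apply 1
  have hv : ∀ b, v b * v b = 1 := fun b => by
    by_cases hb : ∃ x, s x = b
    · obtain ⟨x, rfl⟩ := hb
      rw [hvu, hu]
    · have hvb : v b = 1 := Function.extend_apply' _ _ _ hb
      rw [hvb, mul_one]
  refine ⟨v 0 * v 1, fun L => ?_⟩
  induction L with
  | nil => simp
  | cons p L ih =>
    rw [List.map_cons, List.prod_cons, ih, List.map_cons, List.sum_cons, zpow_add,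
      ← mul_eq_zpow_of_mul_self hv, hvu, hvu]

-- The elements need only be involutions on the orbit of `a` under words; there they act as
-- permutations, so the group statement above applies.
theorem prod_map_mul_smul_eq_self {M α ι : Type*} [Monoid M] [MulAction M α] {t : ι → M}
    {s : ι → ZMod 2} (hs : t.FactorsThrough s) {a : α}
    (ht : ∀ (l : List ι) x, t x • t x • (l.map t).prod • a = (l.map t).prod • a)
    {L : List (ι × ι)} (hL : (L.map fun p => ((s p.2).val : ℤ) - (s p.1).val).sum = 0) :
    (L.map fun p => t p.1 * t p.2).prod • a = a := by
  let K : Set α := {y | ∀ (l : List ι) x, t x • t x • (l.map t).prod • y = (l.map t).prod • y}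
  have hK : ∀ x, ∀ y ∈ K, t x • y ∈ K := fun x y hy l z => by
    simpa [mul_smul] using hy (l ++ [x]) z
  have hinvol : ∀ x, Function.Involutive fun y : K => (⟨t x • y, hK x y y.2⟩ : K) :=
    fun x y => Subtype.ext (by simpa using y.2 [] x)
  let u : ι → Equiv.Perm K := fun x => (hinvol x).toPerm
  have hcoe : ∀ (N : List (ι × ι)) (y : K),
      (((N.map fun p => u p.1 * u p.2).prod y : K) : α) =
        (N.map fun p => t p.1 * t p.2).prod • (y : α) := fun N y => by
    induction N with
    | nil => simp
    | cons p N ih =>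
      rw [List.map_cons, List.prod_cons, List.map_cons, List.prod_cons, mul_smul, mul_smul, ← ih]
      rfl
  obtain ⟨r, hr⟩ := exists_prod_map_mul_eq_zpow (u := u) (s := s)
    (fun x => Equiv.ext (hinvol x)) fun x y hxy => Equiv.ext fun z =>
      Subtype.ext (congrArg (· • (z : α)) (hs hxy))
  rw [← hcoe L ⟨a, ht⟩, hr, hL, zpow_zero, Equiv.Perm.one_apply]

theorem norm_list_prod_map_le_one {ι F : Type*} [NormedAddCommGroup F] [NormedSpace ℂ F]
    {A : ι → F →L[ℂ] F} (hA : ∀ x, ‖A x‖ ≤ 1) (l : List ι) : ‖(l.map A).prod‖ ≤ 1 :=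
  List.prod_induction (‖·‖ ≤ 1)
    (fun B C hB hC => (norm_mul_le B C).trans (mul_le_one₀ hB (norm_nonneg C) hC))
    ContinuousLinearMap.norm_id_le (List.forall_mem_map.2 fun x _ => hA x)

theorem prod_map_apply_eq_sgn_smul {ι F : Type*} [NormedAddCommGroup F] [NormedSpace ℂ F]
    {A : ι → F →L[ℂ] F} {f : ι → ZMod 2} {v : F} (hA : ∀ x, A x v = sgn (f x) • v)
    (l : List ι) : (l.map A).prod v = sgn (l.map f).sum • v := by
  induction l with
  | nil => simp
  | cons x l ih =>
    rw [List.map_cons, List.prod_cons, mul_apply_eq_comp, ih,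
      ContinuousLinearMap.map_smul_of_tower, hA, smul_smul, List.map_cons, List.sum_cons,
      AddChar.map_add_eq_mul, mul_comm]

-- At each site the two self-adjoint contractions generate a dihedral action on the orbit of `ψ`,
-- in which a product of pairs only depends on its total rotation.
theorem HilbertTensor.tensorHom_prod_apply_eq_self {n : ℕ} {E : Fin n → Type}
    [∀ j, NormedAddCommGroup (E j)] [∀ j, InnerProductSpace ℂ (E j)] [∀ j, CompleteSpace (E j)]
    {H : Type} [NormedAddCommGroup H] [InnerProductSpace ℂ H] [CompleteSpace H]
    (T : HilbertTensor E H) {ι : Type*} {A : ι → ∀ j, E j →L[ℂ] E j} {s : ι → Fin n → ZMod 2}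
    (hsa : ∀ x j, IsSelfAdjoint (A x j)) (hA : ∀ x j, ‖A x j‖ ≤ 1)
    (hs : ∀ j, (fun x => A x j).FactorsThrough fun x => s x j) {ψ : H}
    (hψ : ∀ l : List ι, ‖T.tensorHom (l.map A).prod ψ‖ = ‖ψ‖) {L : List (ι × ι)}
    (hL : ∀ j, (L.map fun p => ((s p.2 j).val : ℤ) - (s p.1 j).val).sum = 0) :
    T.tensorHom (L.map fun p => A p.1 * A p.2).prod ψ = ψ := by
  refine T.tensorHom_apply_eq_self_of_mulSingle fun j => ?_
  let site : (E j →L[ℂ] E j) →* (H →L[ℂ] H) :=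
    T.tensorHom.comp (MonoidHom.mulSingle (fun i => E i →L[ℂ] E i) j)
  have hsite : ∀ B, ‖B‖ ≤ 1 → ‖site B‖ ≤ 1 := fun B hB => T.norm_tensorHom_le_one fun i => by
    rcases eq_or_ne i j with rfl | hi
    · simpa using hB
    · rw [MonoidHom.mulSingle_apply, Pi.mulSingle_eq_of_ne hi]
      exact ContinuousLinearMap.norm_id_le
  have hsite_sa : ∀ B, IsSelfAdjoint B → IsSelfAdjoint (site B) := fun B hB =>
    T.isSelfAdjoint_tensorHom <| funext fun i => by
      rcases eq_or_ne i j with rfl | hi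
      · simpa using hB.star_eq
      · simp [hi]
  have hword : ∀ l : List ι, ‖(l.map fun x => site (A x j)).prod ψ‖ = ‖ψ‖ := fun l => by
    have hl := T.norm_tensorHom_mulSingle_apply (A := (l.map A).prod)
      (fun i => by
        rw [Pi.list_prod_apply, List.map_map]
        exact norm_list_prod_map_le_one (fun x => hA x i) l) (hψ l) j
    rw [Pi.list_prod_apply, List.map_map] at hl
    rw [← hl]
    change _ = ‖site _ ψ‖
    rw [map_list_prod, List.map_map]
    rfl
  have hpairs := prod_map_mul_smul_eq_self (M := H →L[ℂ] H) (t := fun x => site (A x j))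
    (fun x y hxy => congrArg site (hs j hxy)) (a := ψ)
    (fun l x => apply_apply_of_norm_apply_eq (hsite_sa _ (hsa x j)) (hsite _ (hA x j))
      ((hword (x :: l)).trans (hword l).symm)) (hL j)
  change site _ ψ = ψ
  rw [Pi.list_prod_apply, map_list_prod, List.map_map, List.map_map]
  simpa [Function.comp_def] using hpairs

section Characters

variable {ι : Type*} [Fintype ι]

theorem exists_dotProduct_eq_one {a : ι → ZMod 2} (ha : a ≠ 0) : ∃ e, a ⬝ᵥ e = 1 := by
  classical
  obtain ⟨i, hi⟩ := Function.ne_iff.1 ha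
  exact ⟨Pi.single i 1, by rw [dotProduct_single_one]; exact (zmod_two_cases _).resolve_left hi⟩

variable [DecidableEq ι]

theorem sum_sgn_dotProduct (a : ι → ZMod 2) :
    ∑ x, sgn (a ⬝ᵥ x) = if a = 0 then 2 ^ Fintype.card ι else 0 := by
  split_ifs with ha
  · simp [ha]
  · obtain ⟨e, he⟩ := exists_dotProduct_eq_one ha
    let χ := sgn.compAddMonoidHom (AddMonoidHom.mk' (a ⬝ᵥ ·) (dotProduct_add a))
    have hχ : χ ≠ 0 := AddChar.ne_zero_iff.2 ⟨e, by norm_num [χ, he]⟩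
    exact AddChar.sum_eq_zero_iff_ne_zero.2 hχ

theorem val_eq_sgn (z : ZMod 2) : (z.val : ℝ) = (1 - sgn z) / 2 := by
  rcases zmod_two_cases z with rfl | rfl
  · simp
  · norm_num [ZMod.val_one]

theorem sum_sgn_mul_val {a : ι → ZMod 2} (ha : a ≠ 0) (b : ι → ZMod 2) (c : ZMod 2) :
    ∑ x, sgn (a ⬝ᵥ x) * ((b ⬝ᵥ x + c).val : ℝ) =
      if a = b then -(sgn c * 2 ^ Fintype.card ι / 2) else 0 := by
  have hterm : ∀ x, sgn (a ⬝ᵥ x) * ((b ⬝ᵥ x + c).val : ℝ) =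
      sgn (a ⬝ᵥ x) / 2 - sgn c / 2 * sgn ((a - b) ⬝ᵥ x) := fun x => by
    have hab : a - b = a + b := funext fun i => CharTwo.sub_eq_add _ _
    rw [hab, val_eq_sgn, add_dotProduct, AddChar.map_add_eq_mul, AddChar.map_add_eq_mul]
    ring
  simp_rw [hterm]
  rw [Finset.sum_sub_distrib, ← Finset.sum_div, ← Finset.mul_sum, sum_sgn_dotProduct,
    sum_sgn_dotProduct, if_neg ha]
  simp only [sub_eq_zero]
  split_ifs <;> ring

theorem sum_eq_sum_hyperplane {M : Type*} [AddCommMonoid M] {a e : ι → ZMod 2}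
    (hae : a ⬝ᵥ e = 1) (f : (ι → ZMod 2) → M) :
    ∑ x, f x = ∑ x with a ⬝ᵥ x = 0, (f x + f (x + e)) := by
  rw [Finset.sum_add_distrib, ← Finset.sum_filter_add_sum_filter_not _ (fun x => a ⬝ᵥ x = 0)]
  congr 1
  refine (Finset.sum_equiv (Equiv.addRight e) (fun x => ?_) fun x _ => rfl).symm
  have hflip : ∀ z : ZMod 2, z = 0 ↔ ¬z + 1 = 0 := by decide
  simpa [dotProduct_add, hae] using hflip (a ⬝ᵥ x)

theorem sum_hyperplane_val_sub {a e b : ι → ZMod 2} (hae : a ⬝ᵥ e = 1) (hab : a ≠ b)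
    (c : ZMod 2) :
    ∑ x with a ⬝ᵥ x = 0, (((b ⬝ᵥ (x + e) + c).val : ℤ) - (b ⬝ᵥ x + c).val) = 0 := by
  have ha : a ≠ 0 := by
    rintro rfl
    simp at hae
  have hsum := sum_sgn_mul_val ha b c
  rw [if_neg hab, sum_eq_sum_hyperplane hae] at hsum
  rw [← @Int.cast_inj ℝ, Int.cast_zero, ← neg_eq_zero, ← hsum, Int.cast_sum,
    ← Finset.sum_neg_distrib]
  refine Finset.sum_congr rfl fun x hx => ?_
  rw [dotProduct_add a, (Finset.mem_filter.1 hx).2, hae]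
  simp
  ring

end Characters

namespace QuantumExperiment

variable {n : ℕ}

/-- On inputs `h j x` the parity of the outputs is `f x` with certainty: deterministic
computation by non-adaptive measurements. It is stated through possible outcomes, so that no
probabilities have to be added up. -/
def Computes {X : Type*} (Q : QuantumExperiment n) (h : Fin n → X → ZMod 2)
    (f : X → ZMod 2) : Prop :=
  ∀ x m, Q.prob (fun j => h j x) m ≠ 0 → ∑ j, m j = f x

variable {Q : QuantumExperiment n} {ι : Type*} [Fintype ι] [DecidableEq ι]

theorem Computes.sum_eq_zero {b : Fin n → ι → ZMod 2} {c : Fin n → ZMod 2}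
    {f : (ι → ZMod 2) → ZMod 2} (hf : Q.Computes (fun j x => b j ⬝ᵥ x + c j) f)
    {a : ι → ZMod 2} (ha : a ≠ 0) (hb : ∀ j, a ≠ b j) : ∑ x, f x = 0 := by
  obtain ⟨l, hl⟩ := Q.exists_weight_pos
  obtain ⟨e, he⟩ := exists_dotProduct_eq_one ha
  have hψ : Q.ψ l ≠ 0 := norm_ne_zero_iff.1 (by rw [Q.norm_ψ]; exact one_ne_zero)
  let B : (ι → ZMod 2) → ∀ j, Q.E j →L[ℂ] Q.E j := fun x j => Q.obs j (b j ⬝ᵥ x + c j)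
  have hB : ∀ x, Q.tensor.tensorHom (B x) (Q.ψ l) = sgn (f x) • Q.ψ l := fun x =>
    Q.tensorHom_obs_apply (hf x) hl
  have hword : ∀ M : List (ι → ZMod 2), ‖Q.tensor.tensorHom (M.map B).prod (Q.ψ l)‖ = ‖Q.ψ l‖ :=
    fun M => by
      rw [map_list_prod, List.map_map]
      refine (congrArg norm (prod_map_apply_eq_sgn_smul hB M)).trans ?_
      rcases zmod_two_cases (M.map f).sum with h | h <;> simp [h]
  let L : List ((ι → ZMod 2) × (ι → ZMod 2)) :=
    (Finset.univ.filter fun x => a ⬝ᵥ x = 0).toList.map fun x => (x, x + e)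
  have hfix : Q.tensor.tensorHom (L.map fun p => B p.1 * B p.2).prod (Q.ψ l) = Q.ψ l := by
    refine Q.tensor.tensorHom_prod_apply_eq_self (s := fun x j => b j ⬝ᵥ x + c j)
      (fun x j => Q.isSelfAdjoint_obs j _) (fun x j => Q.norm_obs_le_one j _)
      (fun j x y hxy => congrArg (Q.obs j) hxy) hword fun j => ?_
    rw [List.map_map]
    exact (Finset.sum_map_toList _ _).trans (sum_hyperplane_val_sub he (hb j) (c j))
  have hsgn : sgn (∑ x, f x) • Q.ψ l = Q.ψ l := by
    have hpair := prod_map_apply_eq_sgn_smul (A := fun p => Q.tensor.tensorHom (B p.1 * B p.2))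
      (f := fun p => f p.1 + f p.2) (v := Q.ψ l) (fun p => by
        rw [map_mul, mul_apply_eq_comp, hB, ContinuousLinearMap.map_smul_of_tower, hB, smul_smul,
          AddChar.map_add_eq_mul, mul_comm]) L
    rw [sum_eq_sum_hyperplane he, ← Finset.sum_map_toList]
    rw [map_list_prod, List.map_map] at hfix
    simpa only [L, List.map_map, Function.comp_def] using hpair.symm.trans hfix
  refine (zmod_two_cases _).resolve_right fun h1 => ?_
  have hone : sgn (∑ x, f x) = 1 :=
    smul_left_injective ℝ hψ (hsgn.trans (one_smul ℝ (Q.ψ l)).symm)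
  norm_num [h1] at hone

end QuantumExperiment

theorem two_pow_sub_one_le_of_computes {n : ℕ} {ι : Type} [Fintype ι] [DecidableEq ι]
    {Q : QuantumExperiment n} {h : Fin n → (ι → ZMod 2) → ZMod 2}
    (hh : ∀ j, IsLinearBoolean (h j)) {f : (ι → ZMod 2) → ZMod 2} (hf : Q.Computes h f)
    (hodd : ∑ x, f x = 1) : 2 ^ Fintype.card ι - 1 ≤ n := by
  choose b c hbc using hh
  obtain rfl : h = fun j x => b j ⬝ᵥ x + c j := funext₂ hbc
  have hocc : ∀ a : {a : ι → ZMod 2 // a ≠ 0}, ∃ j, a = b j := fun a => by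
    by_contra! ha
    exact one_ne_zero (hodd.symm.trans (hf.sum_eq_zero a.2 ha))
  choose site hsite using hocc
  have hinj : Function.Injective site := fun a a' haa' =>
    Subtype.ext ((hsite a).trans (by rw [haa', ← hsite a']))
  simpa using Fintype.card_le_of_injective site hinj

theorem sum_prodFn (k : ℕ) : ∑ x, prodFn k x = 1 := by
  simp only [prodFn]
  rw [← Fintype.prod_sum fun (_ : Fin k) (b : ZMod 2) => b]
  simp [sum_zmod_two]

theorem HilbertTensor.tensorHom_rankOne {n : ℕ} {E : Fin n → Type}
    [∀ j, NormedAddCommGroup (E j)] [∀ j, InnerProductSpace ℂ (E j)] {H : Type}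
    [NormedAddCommGroup H] [InnerProductSpace ℂ H] [CompleteSpace H] (T : HilbertTensor E H)
    (v w : ∀ j, E j) :
    T.tensorHom (fun j => InnerProductSpace.rankOne ℂ (v j) (w j)) =
      InnerProductSpace.rankOne ℂ (T.tmul v) (T.tmul w) :=
  T.ext_tmul fun z => by
    simp only [tensorHom_tmul, InnerProductSpace.rankOne_apply]
    rw [T.tmul.map_smul_univ, T.inner_tmul]

/-- The coordinate model of the tensor product of finite-dimensional Hilbert spaces: product
vectors have the products of the coordinates as coordinates. -/
noncomputable def HilbertTensor.euclidean {n : ℕ} (κ : Fin n → Type) [∀ j, Fintype (κ j)] :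
    HilbertTensor (fun j => EuclideanSpace ℂ (κ j)) (EuclideanSpace ℂ (∀ j, κ j)) where
  tmul := (WithLp.linearEquiv 2 ℂ _).symm.toLinearMap.compMultilinearMap <|
    MultilinearMap.pi fun b => (MultilinearMap.mkPiAlgebra ℂ (Fin n) ℂ).compLinearMap
      fun j => (EuclideanSpace.proj (b j)).toLinearMap
  inner_tmul v w := by
    classical
    simp [PiLp.inner_apply, Finset.prod_univ_sum, Finset.prod_mul_distrib]
  dense_span := by
    classical
    refine dense_univ.mono fun x _ => ?_
    rw [SetLike.mem_coe, ← (EuclideanSpace.basisFun _ ℂ).sum_repr x]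
    refine Submodule.sum_mem _ fun c _ => Submodule.smul_mem _ _ (Submodule.subset_span
      ⟨fun j => EuclideanSpace.single (c j) 1, ?_⟩)
    ext b
    simp [Finset.prod_ite_zero, funext_iff]

theorem HilbertTensor.euclidean_tmul_apply {n : ℕ} {κ : Fin n → Type} [∀ j, Fintype (κ j)]
    (v : ∀ j, EuclideanSpace ℂ (κ j)) (b : ∀ j, κ j) :
    (HilbertTensor.euclidean κ).tmul v b = ∏ j, v j (b j) := rfl

namespace QuantumExperiment

section Projective

variable {n : ℕ} {E : Fin n → Type} [∀ j, NormedAddCommGroup (E j)]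
  [∀ j, InnerProductSpace ℂ (E j)] [∀ j, CompleteSpace (E j)] {H : Type} [NormedAddCommGroup H]
  [InnerProductSpace ℂ H] [CompleteSpace H] (T : HilbertTensor E H) {ψ : H} (hψ : ‖ψ‖ = 1)
  (e : ∀ j, ZMod 2 → OrthonormalBasis (ZMod 2) ℂ (E j))

/-- The pure state `ψ`, measured at site `j` on input `s` in the orthonormal basis `e j s`. -/
noncomputable def projective : QuantumExperiment n where
  E := E
  H := H
  tensor := T
  w := Pi.single 0 1
  w_nonneg l := by
    rcases eq_or_ne l 0 with rfl | hl
    · simp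
    · simp [hl]
  w_sum := hasSum_pi_single 0 1
  ψ _ := ψ
  norm_ψ _ := hψ
  povm j s m := InnerProductSpace.rankOne ℂ (e j s m) (e j s m)
  povm_pos _ _ _ := InnerProductSpace.isPositive_rankOne_self _
  povm_sum j s := (e j s).sum_rankOne_eq_id

theorem isPure_projective : (projective T hψ e).IsPure := ⟨0, by simp [projective]⟩

theorem prob_projective (s m : Fin n → ZMod 2) :
    (projective T hψ e).prob s m = ‖inner ℂ (T.tmul fun j => e j (s j) (m j)) ψ‖ ^ 2 := by
  have hsingle : HasSum (fun l => (projective T hψ e).w l * (projective T hψ e).pureProb s m l)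
      ((projective T hψ e).w 0 * (projective T hψ e).pureProb s m 0) :=
    hasSum_single 0 fun l hl => by simp [projective, hl]
  have hweight : (projective T hψ e).w 0 = 1 := by simp [projective]
  have hpure : (projective T hψ e).pureProb s m 0 = (inner ℂ ψ (T.tensorHom
      (fun j => InnerProductSpace.rankOne ℂ (e j (s j) (m j)) (e j (s j) (m j))) ψ)).re := rfl
  rw [((projective T hψ e).hasSum_prob s m).unique hsingle, hweight, one_mul, hpure,
    T.tensorHom_rankOne, InnerProductSpace.rankOne_apply, inner_smul_right]
  exact (inner_mul_symm_re_eq_norm (𝕜 := ℂ) _ ψ).trans (by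
    rw [norm_mul, norm_inner_symm ψ, sq])

end Projective

end QuantumExperiment

theorem sgn_eq_exp (b : ZMod 2) : (sgn b : ℂ) = Complex.exp (b.val * (Real.pi * Complex.I)) := by
  rw [Complex.exp_nat_mul, Complex.exp_pi_mul_I, sgn, AddChar.zmodChar_apply]
  push_cast
  rfl

/-- The qubit state `(|0⟩ + (-1)^m e^{iθ} |1⟩) / √2` on the equator of the Bloch sphere, with both
coordinates written by one formula so that products of them are easy to form. -/
noncomputable def equator (θ : ℝ) (m : ZMod 2) : EuclideanSpace ℂ (ZMod 2) :=
  WithLp.toLp 2 fun b => (√2 : ℂ)⁻¹ * (sgn (m * b) * Complex.exp (b.val * (θ * Complex.I)))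

theorem ofReal_sqrt_two_mul_self : (√2 : ℂ) * √2 = 2 := by
  rw [← Complex.ofReal_mul, Real.mul_self_sqrt zero_le_two, Complex.ofReal_ofNat]

theorem orthonormal_equator (θ : ℝ) : Orthonormal ℂ (equator θ) := by
  rw [orthonormal_iff_ite]
  intro m m'
  have hinner : ∀ b, inner ℂ (equator θ m b) (equator θ m' b) =
      (√2 : ℂ)⁻¹ * (√2 : ℂ)⁻¹ * (sgn (m * b) * sgn (m' * b)) := fun b => by
    have hphase : Complex.exp (b.val * (θ * Complex.I)) *
        (starRingEnd ℂ) (Complex.exp (b.val * (θ * Complex.I))) = 1 := by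
      rw [Complex.mul_conj', Complex.exp_nat_mul, norm_pow, Complex.norm_exp_ofReal_mul_I]
      simp
    simp only [RCLike.inner_apply, equator, map_mul, map_inv₀, Complex.conj_ofReal]
    linear_combination (√2 : ℂ)⁻¹ * (√2 : ℂ)⁻¹ * (sgn (m * b) * sgn (m' * b)) * hphase
  rw [PiLp.inner_apply, Finset.sum_congr rfl fun b _ => hinner b, ← Finset.mul_sum, ← mul_inv,
    ofReal_sqrt_two_mul_self, sum_zmod_two]
  rcases zmod_two_cases m with rfl | rfl <;> rcases zmod_two_cases m' with rfl | rfl <;>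
    norm_num

/-- The equatorial measurement of angle `θ`: the eigenbasis of `cos θ X + sin θ Y`. -/
noncomputable def equatorBasis (θ : ℝ) :
    OrthonormalBasis (ZMod 2) ℂ (EuclideanSpace ℂ (ZMod 2)) :=
  OrthonormalBasis.mk (orthonormal_equator θ)
    ((orthonormal_equator θ).linearIndependent.span_eq_top_of_card_eq_finrank' (by simp)).ge

theorem prod_equator {ι : Type*} (S : Finset ι) (θ : ι → ℝ) (m : ι → ZMod 2) (b : ZMod 2) :
    ∏ j ∈ S, equator (θ j) (m j) b = (√2 : ℂ)⁻¹ ^ S.card *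
      (sgn ((∑ j ∈ S, m j) * b) * Complex.exp (b.val * ((∑ j ∈ S, θ j : ℝ) * Complex.I))) := by
  simp only [equator, Finset.prod_mul_distrib, Finset.prod_const]
  rw [← Complex.ofReal_prod, ← sgn_sum, ← Finset.sum_mul, ← Complex.exp_sum, ← Finset.mul_sum,
    ← Finset.sum_mul, Complex.ofReal_sum]

theorem sum_prod_equator_ne_zero_iff {ι : Type*} (S : Finset ι) {θ : ι → ℝ} {t : ZMod 2}
    (m : ι → ZMod 2) (ht : Complex.exp ((∑ j ∈ S, θ j : ℝ) * Complex.I) = sgn t) :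
    ∑ b, ∏ j ∈ S, equator (θ j) (m j) b ≠ 0 ↔ ∑ j ∈ S, m j = t := by
  simp_rw [prod_equator, ← Finset.mul_sum, Complex.exp_nat_mul, ht]
  rcases zmod_two_cases (∑ j ∈ S, m j) with h | h <;> rcases zmod_two_cases t with rfl | rfl <;>
    simp [h, sum_zmod_two, ZMod.val_one]

section GHZ

variable {n : ℕ} {β : Type*} [Fintype β] [DecidableEq β]

/-- A product of GHZ states `(|0…0⟩ + |1…1⟩) / √2`, one for each fibre of `γ`: each block `g`
contributes a bit `c g` shared by all its qubits. -/
noncomputable def ghz (γ : Fin n → β) : EuclideanSpace ℂ (Fin n → ZMod 2) :=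
  (√2 : ℂ)⁻¹ ^ Fintype.card β • ∑ c : β → ZMod 2, EuclideanSpace.single (c ∘ γ) 1

theorem norm_ghz {γ : Fin n → β} (hγ : γ.Surjective) : ‖ghz γ‖ = 1 := by
  have hon : Orthonormal ℂ fun c : β → ZMod 2 => EuclideanSpace.single (c ∘ γ) (1 : ℂ) :=
    (EuclideanSpace.orthonormal_single (𝕜 := ℂ)).comp _ hγ.injective_comp_right
  have hsum := hon.inner_sum (fun _ => 1) (fun _ => 1) Finset.univ
  simp only [one_smul] at hsum
  refine (pow_eq_one_iff_of_nonneg (norm_nonneg _) two_ne_zero).1 (Complex.ofReal_injective ?_)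
  refine (Complex.ofReal_pow _ _).trans
    ((inner_self_eq_norm_sq_to_K (𝕜 := ℂ) (ghz γ)).symm.trans ?_)
  rw [ghz, inner_smul_left, inner_smul_right, hsum]
  simp only [map_pow, map_inv₀, Complex.conj_ofReal, map_one, mul_one, Finset.sum_const,
    Finset.card_univ, Fintype.card_fun, ZMod.card, nsmul_eq_mul, Nat.cast_pow, Nat.cast_ofNat]
  rw [← mul_assoc, ← mul_pow, ← mul_pow, ← mul_inv, ofReal_sqrt_two_mul_self,
    inv_mul_cancel₀ two_ne_zero, one_pow, Complex.ofReal_one]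

theorem inner_tmul_ghz (v : Fin n → EuclideanSpace ℂ (ZMod 2)) (γ : Fin n → β) :
    inner ℂ ((HilbertTensor.euclidean _).tmul v) (ghz γ) = (√2 : ℂ)⁻¹ ^ Fintype.card β *
      ∏ g, (starRingEnd ℂ) (∑ b, ∏ j with γ j = g, v j b) := by
  rw [← map_prod, Finset.prod_univ_sum, Fintype.piFinset_univ, ghz, inner_smul_right, inner_sum,
    map_sum]
  congr 1
  refine Finset.sum_congr rfl fun c _ => ?_
  rw [EuclideanSpace.inner_single_right, one_mul, HilbertTensor.euclidean_tmul_apply,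
    ← Finset.prod_fiberwise Finset.univ γ]
  congr 1
  refine Finset.prod_congr rfl fun g _ => Finset.prod_congr rfl fun j hj => ?_
  rw [Function.comp_apply, (Finset.mem_filter.1 hj).2]

/-- Equatorial qubit measurements with angles `θ j s` on a product of GHZ states. -/
noncomputable def ghzExperiment (γ : Fin n → β) (hγ : γ.Surjective) (θ : Fin n → ZMod 2 → ℝ) :
    QuantumExperiment n :=
  .projective (HilbertTensor.euclidean _) (norm_ghz hγ) fun j s => equatorBasis (θ j s)

theorem prob_ghzExperiment_ne_zero_iff {γ : Fin n → β} (hγ : γ.Surjective)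
    {θ : Fin n → ZMod 2 → ℝ} {s : Fin n → ZMod 2} {t : β → ZMod 2}
    (ht : ∀ g, Complex.exp ((∑ j with γ j = g, θ j (s j) : ℝ) * Complex.I) = sgn (t g))
    (m : Fin n → ZMod 2) :
    (ghzExperiment γ hγ θ).prob s m ≠ 0 ↔ ∀ g, ∑ j with γ j = g, m j = t g := by
  have hscale : (√2 : ℂ)⁻¹ ^ Fintype.card β ≠ 0 := by simp
  rw [ghzExperiment, QuantumExperiment.prob_projective, inner_tmul_ghz]
  simp only [equatorBasis, OrthonormalBasis.coe_mk, pow_ne_zero_iff two_ne_zero,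
    norm_ne_zero_iff, mul_ne_zero_iff, and_iff_right hscale, Finset.prod_ne_zero_iff,
    Finset.mem_univ, true_imp_iff, map_ne_zero]
  exact forall_congr' fun g => sum_prod_equator_ne_zero_iff _ _ (ht g)

end GHZ

section ParityPhase

variable {ι : Type*} [Fintype ι] [DecidableEq ι]

/-- The rescaled Fourier coefficients of `f` on `𝔽₂^ι`: a qubit measured at the angle
`parityPhase f a` times the bit `a ⬝ᵥ x` contributes the `a`-th term of the expansion of `π f x`
into parities. -/
noncomputable def parityPhase (f : (ι → ZMod 2) → ZMod 2) (a : ι → ZMod 2) : ℝ :=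
  -(2 * Real.pi / 2 ^ Fintype.card ι) * ∑ y, ((f y).val : ℝ) * sgn (a ⬝ᵥ y)

theorem sum_val_mul_parityPhase {f : (ι → ZMod 2) → ZMod 2} (hf : f 0 = 0) (x : ι → ZMod 2) :
    ∑ a, ((a ⬝ᵥ x).val : ℝ) * parityPhase f a = (f x).val * Real.pi := by
  have hterm : ∀ y, ((f y).val : ℝ) * ∑ a, sgn (y ⬝ᵥ a) * ((x ⬝ᵥ a + 0).val : ℝ) =
      if y = x then -((f x).val * (2 ^ Fintype.card ι / 2) : ℝ) else 0 := fun y => by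
    rcases eq_or_ne y 0 with rfl | hy
    · rcases eq_or_ne 0 x with rfl | hx
      · simp [hf]
      · simp [hf, hx]
    · rw [sum_sgn_mul_val hy]
      split_ifs with hyx
      · rw [hyx, AddChar.map_zero_eq_one]
        ring
      · exact mul_zero _
  calc ∑ a, ((a ⬝ᵥ x).val : ℝ) * parityPhase f a
      = -(2 * Real.pi / 2 ^ Fintype.card ι) *
          ∑ y, ((f y).val : ℝ) * ∑ a, sgn (y ⬝ᵥ a) * ((x ⬝ᵥ a + 0).val : ℝ) := by
        simp only [parityPhase, Finset.mul_sum]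
        rw [Finset.sum_comm]
        refine Finset.sum_congr rfl fun y _ => Finset.sum_congr rfl fun a _ => ?_
        rw [add_zero, dotProduct_comm y, dotProduct_comm x]
        ring
    _ = (f x).val * Real.pi := by
        simp_rw [hterm]
        rw [Finset.sum_ite_eq' Finset.univ x, if_pos (Finset.mem_univ x)]
        field_simp

end ParityPhase

theorem exists_isPure_computes {ι : Type} [Fintype ι] [Nonempty ι]
    {f : (ι → ZMod 2) → ZMod 2} (hf : f 0 = 0) :
    ∃ (Q : QuantumExperiment (2 ^ Fintype.card ι - 1))
      (h : Fin (2 ^ Fintype.card ι - 1) → (ι → ZMod 2) → ZMod 2),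
      Q.IsPure ∧ (∀ j, IsLinearBoolean (h j)) ∧ Q.Computes h f := by
  classical
  have hcard : Fintype.card {a : ι → ZMod 2 // a ≠ 0} = 2 ^ Fintype.card ι - 1 := by
    rw [Fintype.card_subtype_compl, Fintype.card_fun, ZMod.card, Fintype.card_subtype_eq]
  let e : Fin (2 ^ Fintype.card ι - 1) ≃ {a : ι → ZMod 2 // a ≠ 0} :=
    (Fintype.equivFinOfCardEq hcard).symm
  obtain ⟨a, ha⟩ := exists_ne (0 : ι → ZMod 2)
  have hγ : Function.Surjective fun _ : Fin (2 ^ Fintype.card ι - 1) => () :=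
    fun _ => ⟨e.symm ⟨a, ha⟩, rfl⟩
  refine ⟨ghzExperiment _ hγ fun j s => s.val * parityPhase f (e j), fun j x => (e j).1 ⬝ᵥ x,
    QuantumExperiment.isPure_projective _ _ _, fun j => ⟨e j, 0, fun s => by simp [dotProduct]⟩,
    fun x m hm => ?_⟩
  have hangle : ∑ j, (((e j).1 ⬝ᵥ x).val : ℝ) * parityPhase f (e j) = (f x).val * Real.pi := by
    rw [← sum_val_mul_parityPhase hf x,
      Equiv.sum_comp e fun a : {a : ι → ZMod 2 // a ≠ 0} =>
        ((a.1 ⬝ᵥ x).val : ℝ) * parityPhase f a,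
      ← Fintype.sum_subtype_add_sum_subtype (· ≠ (0 : ι → ZMod 2))]
    refine (add_eq_left.2 (Fintype.sum_eq_zero _ fun a => ?_)).symm
    rw [not_not.1 a.2, zero_dotProduct, ZMod.val_zero, Nat.cast_zero, zero_mul]
  have hparity := (prob_ghzExperiment_ne_zero_iff hγ (t := fun _ => f x) (fun _ => by
    rw [Finset.filter_true_of_mem fun _ _ => rfl, hangle, sgn_eq_exp]
    push_cast
    rw [mul_assoc]) m).1 hm ()
  simpa only [Finset.filter_true] using hparity

theorem prodFn_zero {k : ℕ} (hk : 1 ≤ k) : prodFn k 0 = 0 :=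
  Finset.prod_eq_zero (Finset.mem_univ ⟨0, hk⟩) rfl

theorem exists_isPure_computes_prodFn {k : ℕ} (hk : 1 ≤ k) :
    ∃ (Q : QuantumExperiment (2 ^ k - 1)) (h : Fin (2 ^ k - 1) → (Fin k → ZMod 2) → ZMod 2),
      Q.IsPure ∧ (∀ j, IsLinearBoolean (h j)) ∧ Q.Computes h (prodFn k) := by
  have : Nonempty (Fin k) := ⟨⟨0, hk⟩⟩
  have hcomp := exists_isPure_computes (prodFn_zero hk)
  rwa [Fintype.card_fin] at hcomp

theorem two_pow_sub_one_le_of_computes_prodFn {n k : ℕ} {Q : QuantumExperiment n}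
    {h : Fin n → (Fin k → ZMod 2) → ZMod 2} (hh : ∀ j, IsLinearBoolean (h j))
    (hf : Q.Computes h (prodFn k)) : 2 ^ k - 1 ≤ n := by
  simpa only [Fintype.card_fin] using two_pow_sub_one_le_of_computes hh hf (sum_prodFn k)

theorem performedByNMBQC_iff {n k : ℕ} {f : (Fin k → ZMod 2) → ZMod 2} :
    PerformedByNMBQC n f ↔ ∃ (Q : QuantumExperiment n) (h : Fin n → (Fin k → ZMod 2) → ZMod 2),
      Q.IsPure ∧ (∀ j, IsLinearBoolean (h j)) ∧ Q.Computes h f := by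
  simp only [PerformedByNMBQC, QuantumExperiment.sum_prob_eq_one_iff, QuantumExperiment.Computes]

theorem isLeast_performedByNMBQC_prodFn {k : ℕ} (hk : 1 ≤ k) :
    IsLeast {n : ℕ | PerformedByNMBQC n (prodFn k)} (2 ^ k - 1) := by
  refine ⟨performedByNMBQC_iff.2 (exists_isPure_computes_prodFn hk), fun n hn => ?_⟩
  obtain ⟨Q, h, -, hh, hf⟩ := performedByNMBQC_iff.1 hn
  exact two_pow_sub_one_le_of_computes_prodFn hh hf

section Correlators

variable {n k : ℕ}

theorem acceptedProb_nonneg (Q : QuantumExperiment n) (g : PostSelection n k) (x : Fin k → ZMod 2)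
    (C : (Fin n → ZMod 2) → (Fin n → ZMod 2) → Prop) : 0 ≤ acceptedProb Q g x C := by
  refine Finset.sum_nonneg fun s _ => Finset.sum_nonneg fun m _ => ?_
  split_ifs
  exacts [mul_nonneg (by positivity) (Q.prob_nonneg s m), le_rfl]

theorem acceptedProb_eq_zero_iff {Q : QuantumExperiment n} {g : PostSelection n k}
    {x : Fin k → ZMod 2} {C : (Fin n → ZMod 2) → (Fin n → ZMod 2) → Prop} :
    acceptedProb Q g x C = 0 ↔ ∀ s m, g.Accepts x s m → Q.prob s m ≠ 0 → ¬C s m := by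
  classical
  have hterm : ∀ s m, 0 ≤ if g.Accepts x s m ∧ C s m then (1 / 2 : ℝ) ^ n * Q.prob s m else 0 :=
    fun s m => ite_nonneg (mul_nonneg (by positivity) (Q.prob_nonneg s m)) le_rfl
  rw [acceptedProb, Finset.sum_eq_zero_iff_of_nonneg fun s _ => Finset.sum_nonneg fun m _ =>
    hterm s m]
  refine forall_congr' fun s => ?_
  rw [Finset.sum_eq_zero_iff_of_nonneg fun m _ => hterm s m]
  simp only [Finset.mem_univ, true_imp_iff, ite_eq_right_iff, mul_eq_zero, pow_eq_zero_iff',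
    one_div, inv_eq_zero, OfNat.ofNat_ne_zero, false_and, false_or, and_imp]
  exact forall_congr' fun m => forall_congr' fun _ => not_imp_not.symm

theorem acceptedProb_add_not (Q : QuantumExperiment n) (g : PostSelection n k)
    (x : Fin k → ZMod 2) (C : (Fin n → ZMod 2) → (Fin n → ZMod 2) → Prop) :
    acceptedProb Q g x C + acceptedProb Q g x (fun s m => ¬C s m) =
      acceptedProb Q g x fun _ _ => True := by
  simp only [acceptedProb, ← Finset.sum_add_distrib]
  refine Finset.sum_congr rfl fun s _ => Finset.sum_congr rfl fun m _ => ?_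
  by_cases hacc : g.Accepts x s m <;> by_cases hC : C s m <;> simp [hacc, hC]

theorem isCorrelator_vertex_iff {Q : QuantumExperiment n} {g : PostSelection n k}
    {f : (Fin k → ZMod 2) → ZMod 2} :
    IsCorrelator Q g (vertex f) ↔ ∀ x, (∃ s m, g.Accepts x s m ∧ Q.prob s m ≠ 0) ∧
      ∀ s m, g.Accepts x s m → Q.prob s m ≠ 0 → ∑ j, m j = f x := by
  refine forall_congr' fun x => ?_
  have hpos : 0 < acceptedProb Q g x (fun _ _ => True) ↔
      ∃ s m, g.Accepts x s m ∧ Q.prob s m ≠ 0 := by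
    rw [(acceptedProb_nonneg Q g x _).lt_iff_ne', Ne, acceptedProb_eq_zero_iff]
    push Not
    simp only [and_true]
  rw [hpos]
  refine and_congr_right fun h => ?_
  have htotal := (hpos.2 h).ne'
  rcases zmod_two_cases (f x) with hfx | hfx
  · rw [vertex, hfx, if_neg zero_ne_one, eq_comm, div_eq_zero_iff, or_iff_left htotal,
      acceptedProb_eq_zero_iff]
    have hbit : ∀ z : ZMod 2, ¬z = 1 ↔ z = 0 := by decide
    simp only [hbit]
  · rw [vertex, hfx, if_pos rfl, eq_comm, div_eq_one_iff_eq htotal, ← acceptedProb_add_not,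
      left_eq_add, acceptedProb_eq_zero_iff]
    simp only [not_not]

theorem vertex_mem_liCorrelators_iff {f : (Fin k → ZMod 2) → ZMod 2} :
    vertex f ∈ liCorrelators n k ↔
      ∃ (Q : QuantumExperiment n) (h : Fin n → (Fin k → ZMod 2) → ZMod 2),
        (∀ j, IsLinearBoolean (h j)) ∧ Q.Computes h f := by
  constructor
  · rintro ⟨Q, g, ⟨h, hh, hg⟩, hQ⟩
    exact ⟨Q, h, hh, fun x m => (isCorrelator_vertex_iff.1 hQ x).2 _ m fun j => (hg j x _).symm⟩
  · rintro ⟨Q, h, hh, hf⟩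
    refine ⟨Q, fun j x _ => h j x, ⟨h, hh, fun _ _ _ => rfl⟩,
      isCorrelator_vertex_iff.2 fun x => ⟨?_, fun s m hs => ?_⟩⟩
    · obtain ⟨m, hm⟩ := Q.exists_prob_ne_zero fun j => h j x
      exact ⟨_, m, fun _ => rfl, hm⟩
    · obtain rfl : s = fun j => h j x := funext hs
      exact hf x m

theorem isLeast_vertex_prodFn_mem_liCorrelators (hk : 1 ≤ k) :
    IsLeast {n : ℕ | vertex (prodFn k) ∈ liCorrelators n k} (2 ^ k - 1) := by
  constructor
  · obtain ⟨Q, h, -, hh, hf⟩ := exists_isPure_computes_prodFn hk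
    exact vertex_mem_liCorrelators_iff.2 ⟨Q, h, hh, hf⟩
  · intro n hn
    obtain ⟨Q, h, hh, hf⟩ := vertex_mem_liCorrelators_iff.1 hn
    exact two_pow_sub_one_le_of_computes_prodFn hh hf

theorem PostSelection.IsLI.isLOI {g : PostSelection n k} (hg : g.IsLI) : g.IsLOI := fun j => by
  obtain ⟨h, hh, hgh⟩ := hg
  obtain ⟨a, b, hab⟩ := hh j
  exact ⟨Sum.elim a 0, b, fun y => by simp [hgh, hab, Fintype.sum_sum_type]⟩

theorem liCorrelators_subset_loiCorrelators (n k : ℕ) :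
    liCorrelators n k ⊆ loiCorrelators n k :=
  fun _ ⟨Q, g, hg, hQ⟩ => ⟨Q, g, hg.isLOI, hQ⟩

end Correlators

namespace IsLinearBoolean

variable {ι : Type} [Fintype ι]

theorem const (b : ZMod 2) : IsLinearBoolean fun _ : ι → ZMod 2 => b :=
  ⟨0, b, fun s => by simp⟩

theorem coord (i : ι) : IsLinearBoolean fun s : ι → ZMod 2 => s i := by
  classical
  exact ⟨Pi.single i 1, 0, fun s => by simp [Pi.single_apply]⟩

theorem add {f g : (ι → ZMod 2) → ZMod 2} (hf : IsLinearBoolean f) (hg : IsLinearBoolean g) :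
    IsLinearBoolean fun s => f s + g s := by
  obtain ⟨a, b, hab⟩ := hf
  obtain ⟨a', b', hab'⟩ := hg
  refine ⟨a + a', b + b', fun s => ?_⟩
  simp only [hab, hab', Pi.add_apply, add_mul, Finset.sum_add_distrib]
  exact add_add_add_comm _ _ _ _

theorem sum {κ : Type*} {f : κ → (ι → ZMod 2) → ZMod 2} (hf : ∀ i, IsLinearBoolean (f i))
    (t : Finset κ) : IsLinearBoolean fun s => ∑ i ∈ t, f i s := by
  classical
  induction t using Finset.induction_on with
  | empty => simpa only [Finset.sum_empty] using const 0
  | insert i t hi ih => simpa only [Finset.sum_insert hi] using (hf i).add ih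

end IsLinearBoolean

namespace AndChain

variable {r : ℕ}

/-- The position of a site in its three-qubit GHZ state. -/
def role (j : Fin (3 * r)) : Fin 3 := (finProdFinEquiv.symm j).1

/-- The GHZ state to which a site belongs. -/
def block (j : Fin (3 * r)) : Fin r := (finProdFinEquiv.symm j).2

theorem sum_block {M : Type*} [AddCommMonoid M] (F : Fin 3 → Fin r → M) (i : Fin r) :
    ∑ j with block j = i, F (role j) (block j) = ∑ t, F t i := by
  rw [Finset.sum_filter, ← Equiv.sum_comp finProdFinEquiv, Fintype.sum_prod_type]
  simp [block, role]

theorem block_surjective : Function.Surjective (block : Fin (3 * r) → Fin r) := fun i =>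
  ⟨finProdFinEquiv (0, i), congrArg Prod.snd (finProdFinEquiv.symm_apply_apply (0, i))⟩

/-- The angles by which an input `1` turns the measurements at the three sites of a GHZ state. On
inputs `u`, `v`, `u + v` they add up to `π u v`, because `u + v - (u ⊕ v) = 2 u v`. -/
noncomputable def slope : Fin 3 → ℝ := ![Real.pi / 2, Real.pi / 2, -(Real.pi / 2)]

theorem exp_sum_slope (u v : ZMod 2) :
    Complex.exp ((∑ t, ((![u, v, u + v] t).val : ℝ) * slope t : ℝ) * Complex.I) =
      sgn (u * v) := by
  have hval : ∀ u v : ZMod 2, u.val + v.val = (u + v).val + 2 * (u * v).val := by decide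
  have hcast : (u.val : ℝ) + v.val = (u + v).val + 2 * (u * v).val := mod_cast hval u v
  have hangle : ∑ t, ((![u, v, u + v] t).val : ℝ) * slope t = (u * v).val * Real.pi := by
    simp only [slope, Fin.sum_univ_three, Matrix.cons_val]
    linear_combination Real.pi / 2 * hcast
  rw [hangle, sgn_eq_exp]
  push_cast
  rw [mul_assoc]

/-- The sum of the outputs at the GHZ states before the `i`-th. -/
def prefixParity (m : Fin (3 * r) → ZMod 2) (i : Fin (r + 1)) : ZMod 2 :=
  ∑ j with (block j).castSucc < i, m j

theorem prefixParity_zero (m : Fin (3 * r) → ZMod 2) : prefixParity m 0 = 0 := by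
  simp [prefixParity]

theorem prefixParity_last (m : Fin (3 * r) → ZMod 2) :
    prefixParity m (Fin.last r) = ∑ j, m j := by
  rw [prefixParity, Finset.filter_true_of_mem fun j _ => Fin.castSucc_lt_last _]

theorem prefixParity_succ (m : Fin (3 * r) → ZMod 2) (i : Fin r) :
    prefixParity m i.succ = prefixParity m i.castSucc + ∑ j with block j = i, m j := by
  simp only [prefixParity, Fin.castSucc_lt_succ_iff, Fin.castSucc_lt_castSucc_iff, le_iff_lt_or_eq,
    Finset.filter_or]
  exact Finset.sum_union (Finset.disjoint_filter.2 fun j _ hlt heq => hlt.ne heq)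

/-- The first input bit of the `i`-th GHZ state: the parity of all earlier outputs, or `x 0` at
the start of the chain. -/
def leftInput (x : Fin (r + 1) → ZMod 2) (m : Fin (3 * r) → ZMod 2) (i : Fin (r + 1)) : ZMod 2 :=
  prefixParity m i + if i = 0 then x 0 else 0

/-- The second input bit of the `i`-th GHZ state. Adding `1` away from the start of the chain makes
the block output `u x + u` rather than `u x`, which cancels the parity `u` of the earlier
outputs. -/
def rightInput (x : Fin (r + 1) → ZMod 2) (i : Fin r) : ZMod 2 :=
  x i.succ + if i.castSucc = 0 then 0 else 1

theorem leftInput_succ {x : Fin (r + 1) → ZMod 2} {m : Fin (3 * r) → ZMod 2} {i : Fin r}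
    (h : ∑ j with block j = i, m j = leftInput x m i.castSucc * rightInput x i) :
    leftInput x m i.succ = leftInput x m i.castSucc * x i.succ := by
  rw [leftInput, prefixParity_succ, h, if_neg (Fin.succ_ne_zero i), add_zero, leftInput,
    rightInput]
  split_ifs with hi
  · rw [hi, prefixParity_zero, zero_add, zero_add, add_zero]
  · linear_combination CharTwo.add_self_eq_zero (prefixParity m i.castSucc)

/-- The product of the bits `x 0, …, x i`. -/
def prefixProd (x : Fin (r + 1) → ZMod 2) (i : Fin (r + 1)) : ZMod 2 := ∏ l ∈ Finset.Iic i, x l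

theorem prefixProd_zero (x : Fin (r + 1) → ZMod 2) : prefixProd x 0 = x 0 := by
  rw [prefixProd, ← bot_eq_zero, Finset.Iic_bot, Finset.prod_singleton]

theorem prefixProd_last (x : Fin (r + 1) → ZMod 2) :
    prefixProd x (Fin.last r) = prodFn (r + 1) x := by
  rw [prefixProd, ← Fin.top_eq_last, Finset.Iic_top, prodFn]

theorem prefixProd_succ (x : Fin (r + 1) → ZMod 2) (i : Fin r) :
    prefixProd x i.succ = prefixProd x i.castSucc * x i.succ := by
  have hIio : Finset.Iio i.succ = Finset.Iic i.castSucc := by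
    ext l
    rw [Finset.mem_Iio, Finset.mem_Iic, Fin.le_castSucc_iff]
  rw [prefixProd, ← Finset.Iio_insert, Finset.prod_insert Finset.notMem_Iio_self,
    mul_comm, hIio, prefixProd]

theorem leftInput_eq_prefixProd {x : Fin (r + 1) → ZMod 2} {m : Fin (3 * r) → ZMod 2}
    (h : ∀ i : Fin r, leftInput x m i.castSucc = prefixProd x i.castSucc →
      ∑ j with block j = i, m j = prefixProd x i.castSucc * rightInput x i) (i : Fin (r + 1)) :
    leftInput x m i = prefixProd x i := by
  induction i using Fin.induction with
  | zero => rw [leftInput, prefixParity_zero, if_pos rfl, zero_add, prefixProd_zero]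
  | succ i ih => rw [leftInput_succ (by rw [h i ih, ih]), ih, prefixProd_succ]

/-- The post-selection that feeds the outputs of the GHZ states forward along the chain. -/
def rule (r : ℕ) : PostSelection (3 * r) (r + 1) := fun j x m =>
  let u := (∑ i with block i.1 < block j, m i) + if (block j).castSucc = 0 then x 0 else 0
  let v := rightInput x (block j)
  ![u, v, u + v] (role j)

theorem rule_apply (j : Fin (3 * r)) (x : Fin (r + 1) → ZMod 2) (m : Fin (3 * r) → ZMod 2) :
    rule r j x (fun i => m i) =
      (let u := leftInput x m (block j).castSucc
       let v := rightInput x (block j)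
       ![u, v, u + v] (role j)) := by
  have hsum : ∑ i : {i // i ≠ j} with block i.1 < block j, m i =
      prefixParity m (block j).castSucc := by
    simp only [prefixParity, Fin.castSucc_lt_castSucc_iff]
    refine Finset.sum_nbij Subtype.val (fun i hi => ?_) Subtype.val_injective.injOn
      (fun i hi => ?_) fun _ _ => rfl
    · simpa using hi
    · have hlt : block i < block j := by simpa using hi
      exact ⟨⟨i, fun hij => hlt.ne (congrArg block hij)⟩, by simpa using hlt, rfl⟩
  simp only [rule, leftInput, hsum]

theorem isLOI_rule (r : ℕ) : (rule r).IsLOI := fun j => by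
  have hu : IsLinearBoolean fun y : Fin (r + 1) ⊕ {i // i ≠ j} → ZMod 2 =>
      (∑ i : {i // i ≠ j} with block i.1 < block j, y (.inr i)) +
        if (block j).castSucc = 0 then y (.inl 0) else 0 := by
    refine (IsLinearBoolean.sum (fun i => IsLinearBoolean.coord (Sum.inr i)) _).add ?_
    split_ifs
    exacts [.coord _, .const 0]
  have hv : IsLinearBoolean fun y : Fin (r + 1) ⊕ {i // i ≠ j} → ZMod 2 =>
      rightInput (fun a => y (.inl a)) (block j) :=
    (IsLinearBoolean.coord _).add (.const _)
  simp only [rule]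
  match role j with
  | 0 => exact hu
  | 1 => exact hv
  | 2 => exact hu.add hv

/-- The experiment on `r` three-qubit GHZ states. -/
noncomputable def experiment (r : ℕ) : QuantumExperiment (3 * r) :=
  ghzExperiment block block_surjective fun j s => s.val * slope (role j)

theorem prob_experiment_ne_zero_iff {x : Fin (r + 1) → ZMod 2} {s m : Fin (3 * r) → ZMod 2}
    (hs : (rule r).Accepts x s m) : (experiment r).prob s m ≠ 0 ↔
      ∀ i, ∑ j with block j = i, m j = leftInput x m i.castSucc * rightInput x i := by
  refine prob_ghzExperiment_ne_zero_iff _ (fun i => ?_) m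
  obtain rfl : s = fun j => rule r j x fun i => m i := funext hs
  simp only [rule_apply]
  let F (t : Fin 3) (i : Fin r) : ℝ :=
    (let u := leftInput x m i.castSucc
     let v := rightInput x i
     (![u, v, u + v] t).val) * slope t
  rw [← exp_sum_slope]
  exact congrArg (fun θ : ℝ => Complex.exp (θ * Complex.I)) (sum_block F i)

theorem exists_accepts_and_prob_ne_zero (x : Fin (r + 1) → ZMod 2) :
    ∃ s m, (rule r).Accepts x s m ∧ (experiment r).prob s m ≠ 0 := by
  let F (t : Fin 3) (i : Fin r) : ZMod 2 :=
    if t = 0 then prefixProd x i.castSucc * rightInput x i else 0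
  let m : Fin (3 * r) → ZMod 2 := fun j => F (role j) (block j)
  have hm : ∀ i, ∑ j with block j = i, m j = prefixProd x i.castSucc * rightInput x i :=
    fun i => (sum_block F i).trans (by simp [F])
  refine ⟨fun j => rule r j x fun i => m i, m, fun j => rfl,
    (prob_experiment_ne_zero_iff fun j => rfl).2 fun i => ?_⟩
  rw [hm, leftInput_eq_prefixProd fun i _ => hm i]

theorem sum_eq_prodFn (hr : 0 < r) {x : Fin (r + 1) → ZMod 2} {s m : Fin (3 * r) → ZMod 2}
    (hs : (rule r).Accepts x s m) (hp : (experiment r).prob s m ≠ 0) :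
    ∑ j, m j = prodFn (r + 1) x := by
  have hblock := (prob_experiment_ne_zero_iff hs).1 hp
  have hne : Fin.last r ≠ 0 := Fin.ext_iff.not.2 hr.ne'
  have hlast := leftInput_eq_prefixProd (fun i hi => by rw [hblock, hi]) (Fin.last r)
  rwa [leftInput, if_neg hne, add_zero, prefixParity_last,
    prefixProd_last] at hlast

theorem isCorrelator_experiment (hr : 0 < r) :
    IsCorrelator (experiment r) (rule r) (vertex (prodFn (r + 1))) :=
  isCorrelator_vertex_iff.2 fun x =>
    ⟨exists_accepts_and_prob_ne_zero x, fun _ _ => sum_eq_prodFn hr⟩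

end AndChain

theorem vertex_prodFn_mem_loiCorrelators {k : ℕ} (hk : 2 ≤ k) :
    vertex (prodFn k) ∈ loiCorrelators (3 * (k - 1)) k := by
  obtain ⟨r, rfl⟩ := Nat.exists_eq_add_of_le' hk
  exact ⟨AndChain.experiment _, AndChain.rule _, AndChain.isLOI_rule _,
    AndChain.isCorrelator_experiment r.succ_pos⟩

theorem three_mul_pred_lt_two_pow_pred {k : ℕ} (hk : 3 ≤ k) : 3 * (k - 1) < 2 ^ k - 1 := by
  induction k, hk using Nat.le_induction with
  | base => norm_num
  | succ k hk ih =>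
    rw [pow_succ]
    lia

theorem liCorrelators_ssubset_loiCorrelators {k : ℕ} (hk : 3 ≤ k) :
    liCorrelators (3 * (k - 1)) k ⊂ loiCorrelators (3 * (k - 1)) k := by
  refine (Set.ssubset_iff_of_subset (liCorrelators_subset_loiCorrelators _ _)).2
    ⟨_, vertex_prodFn_mem_loiCorrelators (by lia), fun hLI => ?_⟩
  have hle := (isLeast_vertex_prodFn_mem_liCorrelators (by lia)).2 hLI
  exact hle.not_gt (three_mul_pred_lt_two_pow_pred hk)

end BellTest

theorem theorem4p2p3 :
    -- the vertex is attained under LOI with `3 (k - 1)` parties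
    (∀ k : ℕ, 2 ≤ k →
      BellTest.vertex (BellTest.prodFn k) ∈ BellTest.loiCorrelators (3 * (k - 1)) k) ∧
    -- under LI, and in nMBQC, the least sufficient number of parties is `2 ^ k - 1`
    (∀ k : ℕ, 1 ≤ k →
      IsLeast {n : ℕ | BellTest.vertex (BellTest.prodFn k) ∈ BellTest.liCorrelators n k}
        (2 ^ k - 1) ∧
      IsLeast {n : ℕ | BellTest.PerformedByNMBQC n (BellTest.prodFn k)} (2 ^ k - 1)) ∧
    -- the LOI set contains the LI set, strictly for `3 ≤ k` and `n = 3 (k - 1)`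
    (∀ n k : ℕ, BellTest.liCorrelators n k ⊆ BellTest.loiCorrelators n k) ∧
    (∀ k : ℕ, 3 ≤ k →
      BellTest.liCorrelators (3 * (k - 1)) k ⊂ BellTest.loiCorrelators (3 * (k - 1)) k) := by
  refine ⟨fun k hk => BellTest.vertex_prodFn_mem_loiCorrelators hk, fun k hk => ⟨?_, ?_⟩,
    BellTest.liCorrelators_subset_loiCorrelators,
    fun k hk => BellTest.liCorrelators_ssubset_loiCorrelators hk⟩
  · exact BellTest.isLeast_vertex_prodFn_mem_liCorrelators hk
  · exact BellTest.isLeast_performedByNMBQC_prodFn hk
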